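/- Fix $\alpha\in(1,2)$, $\mu\in(1,2)$ and $c>0$, and put $C_\alpha=\dfrac{c\,\Gamma(2-\alpha)}{\alpha(\alpha-1)}$. Let $X=(X_t)_{t\ge 0}$ be a real-valued process with almost surely càdlàg paths, defined on some probability space, which has independent increments and whose law is specified by the Laplace transforms \[ \mathbb{E}\big[\exp(-\lambda X_t)\big]=\exp\left(\int_0^t ds\int_0^\infty dx\,\big(e^{-\lambda x}-1+\lambda x\big)\,\frac{c}{\mu}\,\frac{1}{x^{\alpha+1}}\,e^{-xs/\mu}\right),\qquad \lambda\ge 0,\ t\ge 0. \] Let $A_t=-C_\alpha\,t^\alpha/\mu^\alpha$ and $\widetilde L_t=X_t+A_t$ for $t\ge 0$. Then, almost surely, $\widetilde L_t\to-\infty$ as $t\to\infty$. -/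

import Mathlib

open MeasureTheory ProbabilityTheory Filter Topology
open scoped NNReal

namespace StableGraph

noncomputable section

/-- A real function on `[0, ∞)` is càdlàg: right-continuous at every `t ≥ 0`, with a finite left
limit at every `t > 0` (at `t = 0` the filter `𝓝[<] 0` is trivial, so nothing is required). -/
def IsCadlagPath (f : ℝ≥0 → ℝ) : Prop :=
  ∀ t : ℝ≥0, ContinuousWithinAt f (Set.Ici t) t ∧ ∃ l : ℝ, Tendsto f (𝓝[<] t) (𝓝 l)

/-- The constant `C_α = c Γ(2 - α) / (α (α - 1))`. -/
def stableConst (α c : ℝ) : ℝ :=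
  c * Real.Gamma (2 - α) / (α * (α - 1))

/-- The exponent
`∫_0^t ds ∫_0^∞ dx (e^{-r x} - 1 + r x) (c / μ) x^{-(α + 1)} e^{- x s / μ}`.
For `1 < α < 2`, `μ > 0` and `r, t ≥ 0` the integrand is nonnegative and both integrals
converge. -/
def laplaceExponent (α μ c t r : ℝ) : ℝ :=
  ∫ s in (0 : ℝ)..t, ∫ x in Set.Ioi (0 : ℝ),
    (Real.exp (-r * x) - 1 + r * x) * (c / μ) * (1 / x ^ (α + 1)) * Real.exp (-x * s / μ)

variable {Ω : Type*} [MeasurableSpace Ω]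

/-- `X` is (a version of) the càdlàg process with independent increments whose law is specified by
the Laplace transforms `E[exp (-r X_t)] = exp (laplaceExponent α μ c t r)`, `r ≥ 0`, `t ≥ 0`. -/
structure IsJosephMartingalePart (α μ c : ℝ) (P : Measure Ω) (X : ℝ≥0 → Ω → ℝ) : Prop where
  measurable : ∀ t : ℝ≥0, Measurable (X t)
  cadlag : ∀ᵐ ω ∂P, IsCadlagPath (fun t : ℝ≥0 => X t ω)
  indepIncrements : HasIndepIncrements X P
  laplace : ∀ (t : ℝ≥0) (r : ℝ), 0 ≤ r →
    Integrable (fun ω => Real.exp (-r * X t ω)) P ∧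
      ∫ ω, Real.exp (-r * X t ω) ∂P = Real.exp (laplaceExponent α μ c (t : ℝ) r)

/-- The deterministic drift `A_t = - C_α t^α / μ^α`. -/
def driftPart (α μ c : ℝ) (t : ℝ≥0) : ℝ :=
  -(stableConst α c * (t : ℝ) ^ α / μ ^ α)

/-- The process `L̃_t = X_t + A_t`. -/
def josephProcess (α μ c : ℝ) (X : ℝ≥0 → Ω → ℝ) (t : ℝ≥0) (ω : Ω) : ℝ :=
  X t ω + driftPart α μ c t

end

end StableGraph

/-!
The drift is `-κ t ^ α` with `κ = C_α / μ ^ α > 0`, while `X_t` has fluctuations of order only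
`t ^ ((α - 1) / 2)`, so that the drift wins. Three estimates make this precise.

* The Laplace exponent satisfies `0 ≤ laplaceExponent α μ c t r ≤ K t ^ (α - 1) r ^ 2`
  (`exists_laplaceExponent_le`). Chebyshev's inequality for `(exp (-X_t / y) - 1) ^ 2` then gives
  `P (|X_t| ≥ y) ≤ 4 (exp (4 K t ^ (α - 1) / y ^ 2) - 1)` (`measureReal_le_abs_le`).
* Ottaviani's inequality for sums of independent variables turns bounds at fixed times into a bound
  for the maximum of `X - X_0` over a finite grid. Right-continuity of the paths, used along
  refining dyadic grids, extends it to an interval (`exists_measure_le_forall_sub_le`).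
* On `[2 ^ n, 2 ^ (n + 1))` apply this with `y` a small multiple of `2 ^ (n α)`. The probability
  that `X - X_0` exceeds half of the drift somewhere on this block is `O (2 ^ (-n))`, so by
  Borel–Cantelli this happens for finitely many `n` only, and eventually
  `X_t + A_t ≤ X_0 - (κ / 2) t ^ α`.
-/

/-! ### A maximal inequality for processes with independent increments -/

/-- **Ottaviani's maximal inequality**, one-sided and additive. Decompose according to the first
index `k` at which the partial sum exceeds `2 * x`: either the final sum still exceeds `x`, or the
later increments, which are independent of that event, sum to less than `-x`. -/
theorem ProbabilityTheory.iIndepFun.measureReal_exists_two_mul_lt_sum_le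
    {Ω : Type*} [MeasurableSpace Ω] {P : Measure Ω} [IsProbabilityMeasure P]
    {D : ℕ → Ω → ℝ} (hD : iIndepFun D P) (hm : ∀ i, Measurable (D i)) (N : ℕ) {x δ : ℝ}
    (hδ : ∀ k ≤ N, P.real {ω | ∑ i ∈ Finset.Ico k N, D i ω < -x} ≤ δ) :
    P.real {ω | ∃ k ≤ N, 2 * x < ∑ i ∈ Finset.range k, D i ω} ≤
      P.real {ω | x < ∑ i ∈ Finset.range N, D i ω} + δ := by
  set S : ℕ → Ω → ℝ := fun k ω => ∑ i ∈ Finset.range k, D i ω with hS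
  set A : ℕ → Set Ω := fun k => {ω | 2 * x < S k ω} ∩ ⋂ j ∈ Finset.range k, {ω | S j ω ≤ 2 * x}
    with hA
  set B : Set Ω := {ω | x < S N ω} with hB
  set C : ℕ → Set Ω := fun k => {ω | ∑ i ∈ Finset.Ico k N, D i ω < -x} with hC
  have hSm : ∀ k, Measurable (S k) := fun k => Finset.measurable_fun_sum _ fun i _ => hm i
  have hAm : ∀ k, MeasurableSet (A k) := fun k =>
    (measurableSet_lt measurable_const (hSm k)).inter
      (Finset.measurableSet_biInter _ fun j _ => measurableSet_le (hSm j) measurable_const)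
  have hBm : MeasurableSet B := measurableSet_lt measurable_const (hSm N)
  have hdisj : ((Finset.range (N + 1) : Finset ℕ) : Set ℕ).PairwiseDisjoint A := by
    intro k _ l _ hkl
    rw [Function.onFun, Set.disjoint_left]
    rintro ω ⟨hk1, hk2⟩ ⟨hl1, hl2⟩
    simp only [Set.mem_iInter, Finset.mem_range, Set.mem_ofPred_eq] at hk1 hk2 hl1 hl2
    rcases lt_or_gt_of_ne hkl with h | h
    · exact absurd (hl2 k h) (not_le.2 hk1)
    · exact absurd (hk2 l h) (not_le.2 hl1)
  have hU : {ω | ∃ k ≤ N, 2 * x < S k ω} = ⋃ k ∈ Finset.range (N + 1), A k := by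
    ext ω
    simp only [Set.mem_ofPred_eq, Set.mem_iUnion, Finset.mem_range, exists_prop, hA,
      Set.mem_inter_iff, Set.mem_iInter]
    constructor
    · intro h
      have h' : ∃ k, 2 * x < S k ω := h.imp fun k hk => hk.2
      classical
      obtain ⟨k, hk, hkx⟩ := h
      refine ⟨Nat.find h', ?_, Nat.find_spec h', fun j hj => not_lt.1 (Nat.find_min h' hj)⟩
      exact Nat.lt_succ_of_le ((Nat.find_min' h' hkx).trans hk)
    · rintro ⟨k, hk, h, -⟩
      exact ⟨k, Nat.lt_succ_iff.1 hk, h⟩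
  have hind : ∀ k, P.real (A k ∩ C k) = P.real (A k) * P.real (C k) := by
    intro k
    have hI : Indep (⨆ i ∈ Set.Iio k, MeasurableSpace.comap (D i) inferInstance)
        (⨆ i ∈ Set.Ici k, MeasurableSpace.comap (D i) inferInstance) P := by
      refine indep_iSup_of_disjoint (fun i => (hm i).comap_le) hD ?_
      exact Set.disjoint_left.2 fun i hi hi' => absurd (Set.mem_Iio.1 hi) (not_lt.2 hi')
    have hmeas : ∀ (I : Set ℕ) (s : Finset ℕ), (∀ i ∈ s, i ∈ I) →
        Measurable[⨆ i ∈ I, MeasurableSpace.comap (D i) inferInstance]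
          (fun ω => ∑ i ∈ s, D i ω) := by
      intro I s hs
      refine Finset.measurable_fun_sum _ fun i hi => ?_
      exact (comap_measurable (D i)).mono
        (le_iSup₂ (f := fun i (_ : i ∈ I) => MeasurableSpace.comap (D i) inferInstance) i (hs i hi))
        le_rfl
    have hS' : ∀ j ≤ k, Measurable[⨆ i ∈ Set.Iio k, MeasurableSpace.comap (D i) inferInstance]
        (S j) := fun j hj => hmeas _ _ fun i hi => (Finset.mem_range.1 hi).trans_le hj
    have h1 : MeasurableSet[⨆ i ∈ Set.Iio k, MeasurableSpace.comap (D i) inferInstance] (A k) :=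
      (measurableSet_lt measurable_const (hS' k le_rfl)).inter
        (Finset.measurableSet_biInter _ fun j hj =>
          measurableSet_le (hS' j (Finset.mem_range.1 hj).le) measurable_const)
    have h2 : MeasurableSet[⨆ i ∈ Set.Ici k, MeasurableSpace.comap (D i) inferInstance] (C k) :=
      measurableSet_lt (hmeas _ _ fun i hi => (Finset.mem_Ico.1 hi).1) measurable_const
    have := (Indep_iff _ _ P).1 hI _ _ h1 h2
    simp only [measureReal_def, this, ENNReal.toReal_mul]
  have hstep : ∀ k ∈ Finset.range (N + 1), P.real (A k) ≤ P.real (A k ∩ B) + P.real (A k) * δ := by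
    intro k hk
    have hkN : k ≤ N := Nat.lt_succ_iff.1 (Finset.mem_range.1 hk)
    have hsub : A k ⊆ (A k ∩ B) ∪ (A k ∩ C k) := by
      intro ω hω
      by_cases h : x < S N ω
      · exact Or.inl ⟨hω, h⟩
      · refine Or.inr ⟨hω, ?_⟩
        have h1 : 2 * x < S k ω := hω.1
        have h2 := Finset.sum_range_add_sum_Ico (fun i => D i ω) hkN
        simp only [hS, hC, Set.mem_ofPred_eq] at h h1 ⊢
        linarith
    calc P.real (A k) ≤ P.real ((A k ∩ B) ∪ (A k ∩ C k)) := measureReal_mono hsub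
      _ ≤ P.real (A k ∩ B) + P.real (A k ∩ C k) := measureReal_union_le _ _
      _ ≤ _ := by
        rw [hind k]
        gcongr
        exact hδ k hkN
  have hδ0 : 0 ≤ δ := measureReal_nonneg.trans (hδ 0 (Nat.zero_le _))
  have hUB : ∑ k ∈ Finset.range (N + 1), P.real (A k ∩ B) ≤ P.real B := by
    rw [← measureReal_biUnion_finset (hdisj.mono fun _ => Set.inter_subset_left)
      fun k _ => (hAm k).inter hBm]
    exact measureReal_mono (Set.iUnion₂_subset fun _ _ => Set.inter_subset_right)
  have hsum : P.real (⋃ k ∈ Finset.range (N + 1), A k) = ∑ k ∈ Finset.range (N + 1), P.real (A k) :=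
    measureReal_biUnion_finset hdisj fun k _ => hAm k
  have hle : ∑ k ∈ Finset.range (N + 1), P.real (A k) ≤ 1 := hsum ▸ measureReal_le_one
  rw [hU]
  calc P.real (⋃ k ∈ Finset.range (N + 1), A k)
      = ∑ k ∈ Finset.range (N + 1), P.real (A k) := hsum
    _ ≤ ∑ k ∈ Finset.range (N + 1), (P.real (A k ∩ B) + P.real (A k) * δ) :=
        Finset.sum_le_sum hstep
    _ = ∑ k ∈ Finset.range (N + 1), P.real (A k ∩ B) +
          (∑ k ∈ Finset.range (N + 1), P.real (A k)) * δ := by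
        rw [Finset.sum_add_distrib, Finset.sum_mul]
    _ ≤ P.real B + 1 * δ := by gcongr
    _ = _ := by rw [one_mul]

/-- For a process with independent increments, a tail bound that holds at each time of a finite
grid controls the running maximum over the whole grid. -/
theorem ProbabilityTheory.HasIndepIncrements.measureReal_exists_four_mul_lt_sub_le
    {Ω : Type*} [MeasurableSpace Ω] {P : Measure Ω} [IsProbabilityMeasure P]
    {X : ℝ≥0 → Ω → ℝ} (hX : HasIndepIncrements X P) (hm : ∀ t, Measurable (X t))
    {t : ℕ → ℝ≥0} (ht : Monotone t) (N : ℕ) {y p : ℝ}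
    (hp : ∀ k ≤ N, P.real {ω | y ≤ |X (t k) ω|} ≤ p) :
    P.real {ω | ∃ k ≤ N, 4 * y < X (t k) ω - X (t 0) ω} ≤ 4 * p := by
  have hpair : ∀ k ≤ N, ∀ l ≤ N, P.real {ω | 2 * y < X (t k) ω - X (t l) ω} ≤ 2 * p := by
    intro k hk l hl
    calc P.real {ω | 2 * y < X (t k) ω - X (t l) ω}
        ≤ P.real ({ω | y ≤ |X (t k) ω|} ∪ {ω | y ≤ |X (t l) ω|}) := by
          refine measureReal_mono fun ω hω => ?_
          by_contra h
          simp only [Set.mem_union, Set.mem_ofPred_eq, not_or, not_le, abs_lt] at h hω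
          linarith
      _ ≤ _ := measureReal_union_le _ _
      _ ≤ 2 * p := by linarith [hp k hk, hp l hl]
  have htel : ∀ k ω, ∑ i ∈ Finset.range k, (X (t (i + 1)) ω - X (t i) ω) =
      X (t k) ω - X (t 0) ω := fun k ω => Finset.sum_range_sub (fun i => X (t i) ω) k
  have hmax := (hX.nat ht).measureReal_exists_two_mul_lt_sum_le
    (fun i => (hm _).sub (hm _)) N (x := 2 * y) (δ := 2 * p) (by
      intro k hk
      refine le_trans (measureReal_mono fun ω hω => ?_) (hpair k hk N le_rfl)
      simp only [Set.mem_ofPred_eq, Finset.sum_Ico_eq_sub _ hk, htel] at hω ⊢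
      linarith)
  simp only [htel, ← mul_assoc] at hmax
  norm_num at hmax
  linarith [hpair N le_rfl 0 (Nat.zero_le _)]

/-- The maximal inequality over a whole time interval, for paths that are right-continuous:
outside a set of small measure all of them stay below the level up to time `T`. -/
theorem StableGraph.exists_measure_le_forall_sub_le
    {Ω : Type*} [MeasurableSpace Ω] {P : Measure Ω} [IsProbabilityMeasure P]
    {X : ℝ≥0 → Ω → ℝ} (hX : HasIndepIncrements X P) (hm : ∀ t, Measurable (X t))
    (T : ℕ) {y p : ℝ} (hp : ∀ t : ℝ≥0, t ≤ T → P.real {ω | y ≤ |X t ω|} ≤ p) :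
    ∃ E : Set Ω, P E ≤ ENNReal.ofReal (4 * p) ∧ ∀ ω ∉ E, IsCadlagPath (fun t => X t ω) →
      ∀ t : ℝ≥0, t < T → X t ω - X 0 ω ≤ 4 * y := by
  set E : ℕ → Set Ω := fun m =>
    {ω | ∃ k ≤ T * 2 ^ m, 4 * y < X ((k : ℝ≥0) / 2 ^ m) ω - X 0 ω} with hE
  have hmono : Monotone E := by
    refine monotone_nat_of_le_succ fun m ω => ?_
    rintro ⟨k, hk, h⟩
    refine ⟨2 * k, by rw [pow_succ]; lia, ?_⟩
    have : ((2 * k : ℕ) : ℝ≥0) / 2 ^ (m + 1) = (k : ℝ≥0) / 2 ^ m := by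
      push_cast
      rw [pow_succ']
      exact mul_div_mul_left _ _ two_ne_zero
    rwa [this]
  have hEp : ∀ m, P (E m) ≤ ENNReal.ofReal (4 * p) := by
    intro m
    have := hX.measureReal_exists_four_mul_lt_sub_le hm
      (t := fun k => (k : ℝ≥0) / 2 ^ m) (fun a b hab => by dsimp only; gcongr)
      (T * 2 ^ m) (y := y) (p := p) (fun k hk => hp _ (by
        rw [div_le_iff₀ (by positivity)]
        exact_mod_cast hk))
    simp only [Nat.cast_zero, zero_div] at this
    rw [← ofReal_measureReal]
    exact ENNReal.ofReal_le_ofReal this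
  refine ⟨⋃ m, E m, ?_, ?_⟩
  · rw [hmono.measure_iUnion]
    exact iSup_le hEp
  · intro ω hω hc t htT
    by_contra! hlt
    have hev : ∀ᶠ s in 𝓝[≥] t, 4 * y < X s ω - X 0 ω :=
      ((hc t).1.tendsto.sub_const (X 0 ω)).eventually (lt_mem_nhds hlt)
    -- The points of the dyadic grids just after `t` converge to `t` from the right.
    have hlim : Tendsto (fun m : ℕ => (⌈t * 2 ^ m⌉₊ : ℝ≥0) / 2 ^ m) atTop (𝓝[≥] t) := by
      refine tendsto_nhdsWithin_iff.2 ⟨?_, Eventually.of_forall fun m => ?_⟩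
      · have hz : Tendsto (fun m : ℕ => t + (1 / 2) ^ m) atTop (𝓝 t) := by
          simpa using (tendsto_pow_atTop_nhds_zero_of_lt_one (r := (1 / 2 : ℝ≥0))
            zero_le (by rw [div_lt_iff₀ (by norm_num)]; norm_num)).const_add t
        refine tendsto_of_tendsto_of_tendsto_of_le_of_le tendsto_const_nhds hz
          (fun m => ?_) fun m => ?_
        · exact (le_div_iff₀ (by positivity)).2 (Nat.le_ceil _)
        · rw [div_le_iff₀ (by positivity), add_mul, ← mul_pow]
          simpa using (Nat.ceil_lt_add_one (bot_le : 0 ≤ t * 2 ^ m)).le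
      · exact Set.mem_Ici.2 ((le_div_iff₀ (by positivity)).2 (Nat.le_ceil _))
    obtain ⟨m, hm'⟩ := (hlim.eventually hev).exists
    refine hω (Set.mem_iUnion.2 ⟨m, ⌈t * 2 ^ m⌉₊, Nat.ceil_le.2 ?_, hm'⟩)
    push_cast
    gcongr

namespace StableGraph

/-! ### Tail bounds from the Laplace transform -/

/-- The Laplace exponent is at most quadratic in `r`, with a coefficient of order `t ^ (α - 1)`:
bound `exp (-r * x) - 1 + r * x` by `(r * x) ^ 2 / 2`, so that the inner integral becomes a Gamma
integral of order `s ^ (α - 2)`. -/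
theorem exists_laplaceExponent_le {α μ c : ℝ} (hα : 1 < α ∧ α < 2) (hμ : 0 < μ) (hc : 0 < c) :
    ∃ K : ℝ, 0 ≤ K ∧ ∀ t r : ℝ, 0 ≤ t → 0 ≤ r →
      0 ≤ laplaceExponent α μ c t r ∧ laplaceExponent α μ c t r ≤ K * t ^ (α - 1) * r ^ 2 := by
  obtain ⟨h1, h2⟩ := hα
  have hG : 0 < Real.Gamma (2 - α) := Real.Gamma_pos_of_pos (by linarith)
  set M : ℝ := c / μ / 2 * μ ^ (2 - α) * Real.Gamma (2 - α) with hM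
  have hM0 : 0 ≤ M := by positivity
  have hpt : ∀ r s x : ℝ, 0 ≤ r → 0 < x →
      0 ≤ (Real.exp (-r * x) - 1 + r * x) * (c / μ) * (1 / x ^ (α + 1)) * Real.exp (-x * s / μ) ∧
      (Real.exp (-r * x) - 1 + r * x) * (c / μ) * (1 / x ^ (α + 1)) * Real.exp (-x * s / μ) ≤
        r ^ 2 * (c / μ / 2) * (x ^ ((2 - α) - 1) * Real.exp (-(s / μ * x))) := by
    intro r s x hr hx
    have hlow : 0 ≤ Real.exp (-r * x) - 1 + r * x := by
      linarith [Real.add_one_le_exp (-r * x)]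
    have hup : Real.exp (-r * x) - 1 + r * x ≤ (r * x) ^ 2 / 2 := by
      have hu : 0 ≤ r * x := by positivity
      have hq := Real.quadratic_le_exp_of_nonneg hu
      have hpos : 0 < 1 + r * x + (r * x) ^ 2 / 2 := by positivity
      have : Real.exp (-r * x) ≤ (1 + r * x + (r * x) ^ 2 / 2)⁻¹ := by
        rw [neg_mul, Real.exp_neg]
        exact inv_anti₀ hpos hq
      have h3 : (1 + r * x + (r * x) ^ 2 / 2)⁻¹ ≤ 1 - r * x + (r * x) ^ 2 / 2 := by
        rw [inv_le_iff_one_le_mul₀ hpos]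
        nlinarith [sq_nonneg ((r * x) ^ 2)]
      linarith
    refine ⟨by positivity, ?_⟩
    have hx2 : x ^ 2 * (1 / x ^ (α + 1)) = x ^ ((2 - α) - 1) := by
      rw [one_div, ← Real.rpow_neg hx.le, ← Real.rpow_natCast x 2, ← Real.rpow_add hx]
      congr 1
      push_cast
      ring
    have hexp : -x * s / μ = -(s / μ * x) := by ring
    rw [hexp]
    calc (Real.exp (-r * x) - 1 + r * x) * (c / μ) * (1 / x ^ (α + 1)) * Real.exp (-(s / μ * x))
        ≤ (r * x) ^ 2 / 2 * (c / μ) * (1 / x ^ (α + 1)) * Real.exp (-(s / μ * x)) := by gcongr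
      _ = r ^ 2 * (c / μ / 2) * ((x ^ 2 * (1 / x ^ (α + 1))) * Real.exp (-(s / μ * x))) := by ring
      _ = _ := by rw [hx2]
  have hinner0 : ∀ r s : ℝ, 0 ≤ r → 0 ≤ ∫ x in Set.Ioi (0 : ℝ),
      (Real.exp (-r * x) - 1 + r * x) * (c / μ) * (1 / x ^ (α + 1)) * Real.exp (-x * s / μ) :=
    fun r s hr => setIntegral_nonneg measurableSet_Ioi fun x hx => (hpt r s x hr hx).1
  have hinner : ∀ r s : ℝ, 0 ≤ r → 0 < s → ∫ x in Set.Ioi (0 : ℝ),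
      (Real.exp (-r * x) - 1 + r * x) * (c / μ) * (1 / x ^ (α + 1)) * Real.exp (-x * s / μ) ≤
        r ^ 2 * M * s ^ (α - 2) := by
    intro r s hr hs
    have hsμ : 0 < s / μ := by positivity
    have key := Real.integral_rpow_mul_exp_neg_mul_Ioi (a := 2 - α) (by linarith) hsμ
    have hint : IntegrableOn (fun x : ℝ => x ^ ((2 - α) - 1) * Real.exp (-(s / μ * x)))
        (Set.Ioi 0) := .of_integral_ne_zero (by rw [key]; positivity)
    calc _ ≤ ∫ x in Set.Ioi (0 : ℝ),
          r ^ 2 * (c / μ / 2) * (x ^ ((2 - α) - 1) * Real.exp (-(s / μ * x))) := by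
          refine integral_mono_of_nonneg ?_ (hint.const_mul _) ?_
          · filter_upwards [ae_restrict_mem measurableSet_Ioi] with x hx using (hpt r s x hr hx).1
          · filter_upwards [ae_restrict_mem measurableSet_Ioi] with x hx using (hpt r s x hr hx).2
      _ = r ^ 2 * M * s ^ (α - 2) := by
          rw [integral_const_mul, key, one_div_div, Real.div_rpow hμ.le hs.le, hM,
            show α - 2 = -(2 - α) by ring, Real.rpow_neg hs.le]
          ring
  refine ⟨M / (α - 1), div_nonneg hM0 (by linarith), fun t r ht hr => ⟨?_, ?_⟩⟩
  · exact intervalIntegral.integral_nonneg ht fun s _ => hinner0 r s hr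
  · have hint : IntervalIntegrable (fun s : ℝ => r ^ 2 * M * s ^ (α - 2)) volume 0 t :=
      (intervalIntegral.intervalIntegrable_rpow' (by linarith)).const_mul _
    have hval : ∫ s in (0 : ℝ)..t, r ^ 2 * M * s ^ (α - 2) =
        M / (α - 1) * t ^ (α - 1) * r ^ 2 := by
      rw [intervalIntegral.integral_const_mul, integral_rpow (Or.inl (by linarith)),
        show α - 2 + 1 = α - 1 by ring, Real.zero_rpow (by linarith)]
      ring
    rw [← hval, laplaceExponent, intervalIntegral.integral_of_le ht,
      intervalIntegral.integral_of_le ht]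
    refine integral_mono_of_nonneg ?_ ((intervalIntegrable_iff_integrableOn_Ioc_of_le ht).1 hint) ?_
    · exact ae_of_all _ fun s => hinner0 r s hr
    · filter_upwards [ae_restrict_mem measurableSet_Ioc] with s hs using hinner r s hr hs.1

/-- Chebyshev's inequality for `(exp (-X / y) - 1) ^ 2`. This controls both tails of `X`, although
exponential moments are available on one side only. -/
theorem measureReal_le_abs_le {Ω : Type*} [MeasurableSpace Ω] {P : Measure Ω}
    [IsProbabilityMeasure P] {X : Ω → ℝ} {φ : ℝ → ℝ} {V y : ℝ} (hy : 0 < y)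
    (hL : ∀ r : ℝ, 0 ≤ r → Integrable (fun ω => Real.exp (-r * X ω)) P ∧
      ∫ ω, Real.exp (-r * X ω) ∂P = Real.exp (φ r))
    (hφ : ∀ r : ℝ, 0 ≤ r → 0 ≤ φ r ∧ φ r ≤ V * r ^ 2) :
    P.real {ω | y ≤ |X ω|} ≤ 4 * (Real.exp (4 * V / y ^ 2) - 1) := by
  have hr : 0 ≤ y⁻¹ := by positivity
  obtain ⟨hi1, he1⟩ := hL y⁻¹ hr
  obtain ⟨hi2, he2⟩ := hL (2 * y⁻¹) (by positivity)
  have hexpand : ∀ ω, (Real.exp (-y⁻¹ * X ω) - 1) ^ 2 =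
      Real.exp (-(2 * y⁻¹) * X ω) - 2 * Real.exp (-y⁻¹ * X ω) + 1 := by
    intro ω
    have : Real.exp (-(2 * y⁻¹) * X ω) = Real.exp (-y⁻¹ * X ω) ^ 2 := by
      rw [← Real.exp_nat_mul]
      congr 1
      push_cast
      ring
    rw [this]
    ring
  have hint : Integrable (fun ω => (Real.exp (-y⁻¹ * X ω) - 1) ^ 2) P := by
    simp only [hexpand]
    exact (hi2.sub (hi1.const_mul 2)).add (integrable_const 1)
  have hval : ∫ ω, (Real.exp (-y⁻¹ * X ω) - 1) ^ 2 ∂P ≤ Real.exp (4 * V / y ^ 2) - 1 := by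
    have heq : ∫ ω, (Real.exp (-y⁻¹ * X ω) - 1) ^ 2 ∂P =
        Real.exp (φ (2 * y⁻¹)) - 2 * Real.exp (φ y⁻¹) + 1 := by
      simp only [hexpand]
      have hd : Integrable (fun ω => Real.exp (-(2 * y⁻¹) * X ω) - 2 * Real.exp (-y⁻¹ * X ω)) P :=
        hi2.sub (hi1.const_mul 2)
      rw [integral_add hd (integrable_const 1), integral_sub hi2 (hi1.const_mul 2),
        integral_const_mul, he1, he2]
      simp
    have h1 : 1 ≤ Real.exp (φ y⁻¹) := Real.one_le_exp (hφ _ hr).1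
    have h2 : Real.exp (φ (2 * y⁻¹)) ≤ Real.exp (4 * V / y ^ 2) := by
      refine Real.exp_le_exp.2 ((hφ _ (by positivity)).2.trans_eq ?_)
      field_simp
      ring
    linarith
  have hsub : {ω | y ≤ |X ω|} ⊆ {ω | 1 / 4 ≤ (Real.exp (-y⁻¹ * X ω) - 1) ^ 2} := by
    intro ω hω
    simp only [Set.mem_ofPred_eq] at hω ⊢
    have hyi : y⁻¹ * y = 1 := inv_mul_cancel₀ hy.ne'
    rcases le_abs.1 hω with h | h
    · have hle : -y⁻¹ * X ω ≤ -1 := by nlinarith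
      have h1 : Real.exp (-y⁻¹ * X ω) ≤ 1 / 2 := by
        refine (Real.exp_le_exp.2 hle).trans ?_
        rw [Real.exp_neg, one_div]
        exact inv_anti₀ two_pos (by linarith [Real.add_one_le_exp (1 : ℝ)])
      nlinarith
    · have hle : 1 ≤ -y⁻¹ * X ω := by nlinarith
      nlinarith [Real.add_one_le_exp (-y⁻¹ * X ω)]
  have hmk := mul_meas_ge_le_integral_of_nonneg (ae_of_all P fun ω =>
    sq_nonneg (Real.exp (-y⁻¹ * X ω) - 1)) hint (1 / 4)
  linarith [measureReal_mono (μ := P) hsub]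

end StableGraph

/-! ### The almost sure limit -/

theorem proposition3p1 {Ω : Type*} [MeasurableSpace Ω] (P : Measure Ω) [IsProbabilityMeasure P]
    (α μ c : ℝ) (hα : 1 < α ∧ α < 2) (hμ : 1 < μ ∧ μ < 2) (hc : 0 < c)
    (X : ℝ≥0 → Ω → ℝ) (hX : StableGraph.IsJosephMartingalePart α μ c P X) :
    ∀ᵐ ω ∂P, Tendsto (fun t : ℝ≥0 => StableGraph.josephProcess α μ c X t ω) atTop atBot := by
  have hμ0 : 0 < μ := by linarith
  have hα0 : 0 < α := by linarith
  obtain ⟨K, hK0, hK⟩ := StableGraph.exists_laplaceExponent_le hα hμ0 hc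
  have hC : 0 < StableGraph.stableConst α c := by
    have : 0 < Real.Gamma (2 - α) := Real.Gamma_pos_of_pos (by linarith)
    have : 0 < α - 1 := by linarith
    unfold StableGraph.stableConst
    positivity
  set κ : ℝ := StableGraph.stableConst α c / μ ^ α with hκ
  have hκ0 : 0 < κ := by positivity
  set ε : ℝ := κ / 8 with hε
  have hε0 : 0 < ε := by positivity
  set D : ℝ := 8 * K / ε ^ 2 with hD
  have hD0 : 0 ≤ D := by positivity
  -- On the block `[2 ^ n, 2 ^ (n + 1))` the level is `y = ε * (2 ^ n) ^ α`: with `ε = κ / 8`, the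
  -- bound `4 * y` of the maximal inequality is half of the absolute drift at time `2 ^ n`.
  have htail : ∀ n : ℕ, ∀ t : ℝ≥0, t ≤ ((2 ^ (n + 1) : ℕ) : ℝ≥0) →
      P.real {ω | ε * ((2 : ℝ) ^ n) ^ α ≤ |X t ω|} ≤ 4 * (D * Real.exp D * (1 / 2) ^ n) := by
    intro n t ht
    have ha : (1 : ℝ) ≤ 2 ^ n := one_le_pow₀ one_le_two
    have ht' : (t : ℝ) ≤ 2 * 2 ^ n := by
      have : (t : ℝ) ≤ ((2 ^ (n + 1) : ℕ) : ℝ) := by exact_mod_cast ht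
      simpa [pow_succ'] using this
    refine (StableGraph.measureReal_le_abs_le (V := K * (t : ℝ) ^ (α - 1)) (by positivity)
      (hX.laplace t) fun r hr => hK t r t.2 hr).trans ?_
    have hu : 4 * (K * (t : ℝ) ^ (α - 1)) / (ε * ((2 : ℝ) ^ n) ^ α) ^ 2 ≤ D * (1 / 2) ^ n := by
      have h1 : (t : ℝ) ^ (α - 1) ≤ 2 * 2 ^ n :=
        (Real.rpow_le_rpow t.2 ht' (by linarith)).trans
          (Real.rpow_le_self_of_one_le (by linarith) (by linarith))
      have h2 : (2 : ℝ) ^ n ≤ ((2 : ℝ) ^ n) ^ α := Real.self_le_rpow_of_one_le ha hα.1.le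
      calc 4 * (K * (t : ℝ) ^ (α - 1)) / (ε * ((2 : ℝ) ^ n) ^ α) ^ 2
          ≤ 4 * (K * (2 * 2 ^ n)) / (ε * 2 ^ n) ^ 2 := by gcongr
        _ = D * (1 / 2) ^ n := by
          rw [hD, one_div, inv_pow]
          field_simp
          ring
    have hq : (1 / 2 : ℝ) ^ n ≤ 1 := pow_le_one₀ (by norm_num) (by norm_num)
    set u : ℝ := D * (1 / 2) ^ n with hudef
    have hu0 : 0 ≤ u := by positivity
    have huD : u ≤ D := mul_le_of_le_one_right hD0 hq
    -- `exp u - 1 ≤ u * exp u`, from `1 - u ≤ exp (-u)`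
    have hexp : Real.exp u - 1 ≤ u * Real.exp u := by
      have h1 := Real.add_one_le_exp (-u)
      have h2 : Real.exp (-u) * Real.exp u = 1 := by rw [← Real.exp_add]; simp
      nlinarith [Real.exp_pos u]
    have h3 : u * Real.exp u ≤ D * Real.exp D * (1 / 2) ^ n := by
      calc u * Real.exp u ≤ u * Real.exp D := by gcongr
        _ = _ := by rw [hudef]; ring
    linarith [Real.exp_le_exp.2 hu]
  choose E hEP hE using fun n : ℕ => StableGraph.exists_measure_le_forall_sub_le
    hX.indepIncrements hX.measurable (2 ^ (n + 1)) (htail n)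
  have hsum : ∑' n, P (E n) ≠ ⊤ := by
    have hs : Summable fun n : ℕ => 4 * (4 * (D * Real.exp D * (1 / 2 : ℝ) ^ n)) :=
      ((summable_geometric_two.mul_left _).mul_left _).mul_left _
    exact ne_top_of_le_ne_top hs.tsum_ofReal_ne_top (ENNReal.tsum_le_tsum hEP)
  filter_upwards [ae_eventually_notMem hsum, hX.cadlag] with ω hω hcad
  obtain ⟨N, hN⟩ := eventually_atTop.1 hω
  have hbound : ∀ᶠ t : ℝ≥0 in atTop, StableGraph.josephProcess α μ c X t ω ≤
      X 0 ω + -(κ / 2 * (t : ℝ) ^ α) := by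
    filter_upwards [eventually_ge_atTop ((2 : ℝ≥0) ^ N)] with t ht
    have ht1 : 1 ≤ t := (one_le_pow₀ one_le_two).trans ht
    obtain ⟨n, hn1, hn2⟩ := exists_nat_pow_near ht1 (one_lt_two (α := ℝ≥0))
    have hNn : N ≤ n := by
      have := (pow_lt_pow_iff_right₀ (one_lt_two (α := ℝ≥0))).1 (ht.trans_lt hn2)
      lia
    have hle := hE n ω (hN n hNn) hcad t (by exact_mod_cast hn2)
    have hpow : ((2 : ℝ) ^ n) ^ α ≤ (t : ℝ) ^ α :=
      Real.rpow_le_rpow (by positivity) (by exact_mod_cast hn1) hα0.le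
    have hdrift : StableGraph.driftPart α μ c t = -(κ * (t : ℝ) ^ α) := by
      rw [StableGraph.driftPart, hκ]
      ring
    rw [StableGraph.josephProcess, hdrift]
    have hlevel : 4 * (ε * ((2 : ℝ) ^ n) ^ α) = κ / 2 * ((2 : ℝ) ^ n) ^ α := by
      rw [hε]
      ring
    linarith [mul_le_mul_of_nonneg_left hpow hκ0.le]
  refine tendsto_atBot_mono' _ hbound (tendsto_atBot_add_const_left _ _ ?_)
  exact tendsto_neg_atTop_atBot.comp (((tendsto_rpow_atTop hα0).comp
    (NNReal.tendsto_coe_atTop.2 tendsto_id)).const_mul_atTop (by positivity))
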